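/- **Setting.** Fix $t_0\in\mathbb R$, integers $m,n,m_1,\dots,m_N\ge 0$ and $N\ge 1$ agents $i\in\mathcal N=\{1,\dots,N\}$ with identical internal dynamics, $$\dot y_i=F_i(t,y_i,z_i)+\Gamma_i(t,w_i)u_i,\qquad \dot z_i=Z(t,z_i,y_i),\qquad w_i=W_i(y_i,z_i),\qquad y_i\in\mathbb R^m,\ z_i\in\mathbb R^n,\ w_i\in\mathbb R^{m_i},$$ coupled by $$u_i=\Gamma_i(t,w_i)^{-1}\sum_{j\in\mathcal N_i}\Big(\mu_{ij}^p\big((y_j^p-y_i^p)/\psi_{ij}^p(t)\big)\Big)_{p=1}^m .$$ All norms are maximum norms (for matrices, the induced norm), and solutions are Carathéodory solutions. A solution of the coupled system evolves where the coupling is defined, i.e. where $|y_j^p-y_i^p|<\psi_{ij}^p(t)$ for all edges and all $p$; in particular its initial value lies there. Assume: 1. $F_i,Z,\Gamma_i$ are measurable in $t\ge t_0$, locally Lipschitz in the remaining variables, and bounded on compact sets of these uniformly in $t$; $W_i$ is locally Lipschitz. 2. $\Gamma_i(t,w)$ is invertible for all $t\ge t_0$ and $w$, and $\|\Gamma_i(t,w)^{-1}\|$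 is bounded uniformly in $i,t,w$. 3. The communication graph $\mathcal G$ (with $\mathcal N_i$ the neighbours of $i$) is undirected and connected, with diameter $d_{\mathcal G}$. 4. For every edge and every $p\in\{1,\dots,m\}$, $\psi_{ij}^p=\psi_{ji}^p:[t_0,\infty)\to\mathbb R_{>0}$ is bounded and $C^1$ with bounded derivative, and $\mu_{ij}^p:(-1,1)\to\mathbb R$ is continuous with $\mu_{ij}^p(s)\to\pm\infty$ as $s\to\pm1$ and $\mu_{ij}^p(-s)=-\mu_{ji}^p(s)$. Put $\Psi(t)=\max_{p}\max_{(j,i)}\psi_{ij}^p(t)$, the inner maximum running over the edges (with $\Psi=0$ if there is nothing to maximize over). 5. For every $\tau\ge t_0$ and all locally absolutely continuous $e_i:[\tau,\infty)\to\mathbb R^m$ with $\|e_i(t)\|\le d_{\mathcal G}\Psi(t)$, the system $\dot s=\frac1N\sum_iF_i(t,s+e_i,z_i)$, $\dot z_i=Z(t,z_i,s+e_i)$ has a solution on $[\tau,\infty)$ for all initial values at $\tau$. A system $\dot x=f(t,x,u)$ is *$\delta$-ISS with $(\beta,\hat\gamma)$*, where $\beta\in\mathcal{KL}$ and $\hat\gamma\in\mathcal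 K_\infty$, if for every initial time $\tau\ge t_0$ it has a solution on $[\tau,\infty)$ for every initial value and every measurable, locally essentially bounded input, and if any two solutions $x,x'$ on $[\tau,\infty)$ with such inputs $u,u'$ satisfy $$\|x(t)-x'(t)\|\le\beta(\|x(\tau)-x'(\tau)\|,t-\tau)+\hat\gamma\Big(\sup_{s\in[\tau,t)}\|u(s)-u'(s)\|\Big)\quad\text{for all } t\ge\tau .$$ (A supremum over the empty set is $0$.) **Hypotheses.** The internal dynamics $\dot z=Z(t,z,s)$ with input $s$ are $\delta$-ISS with $(\tilde\beta,\bar\gamma)$, and the perturbed reduced-order blended dynamics $$\dot s=\tfrac1N\sum_iF_i(t,s+e_i,z+d_i),\qquad \dot z=Z(t,z,s+e_0)$$ with input $(e_0,e_1,\dots,e_N,d_1,\dots,d_N)$ are $\delta$-ISS with $(\beta,\hat\gamma)$. **Claim.** Let $M>0$ and let $\tilde w:[0,\infty)\to(0,1]$ be decreasing with limit $0$. For $\tilde\gamma\in\mathcal K_\infty$ and a solution of the coupled system let $$D(t)=\max_{i,j}\tilde\beta(\|z_j(t_0)-z_i(t_0)\|,t-t_0)+\tilde\gamma\Big(\sup_{s\in[t_0,t)}d_{\mathcal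 G}\Psi(s)\tilde w(t-s)\Big).$$ (a) There is $\tilde\gamma\in\mathcal K_\infty$ such that $\|z_j(t)-z_i(t)\|\le D(t)$ for all $i,j$, along every solution of the coupled system with $\max_{i,j}\|z_j(t_0)-z_i(t_0)\|\le M$. (b) For every $\tilde\gamma$ as in (a) and every decreasing $w:[0,\infty)\to(0,1]$ with limit $0$ there is $\gamma\in\mathcal K_\infty$ such that for every solution of the coupled system with $\max_{i,j}\|z_j(t_0)-z_i(t_0)\|\le M$, for every $i\in\mathcal N$, and for every solution $(\tilde s,\tilde z)$ of the reduced-order blended dynamics $$\dot{\tilde s}=\tfrac1N\sum_iF_i(t,\tilde s,\tilde z),\quad \dot{\tilde z}=Z(t,\tilde z,\tilde s),\qquad \tilde s(t_0)=\tfrac1N\sum_iy_i(t_0),\quad \tilde z(t_0)=\tfrac1N\sum_iz_i(t_0),$$ one has $$\left\|\begin{bmatrix}y_i(t)\\z_i(t)\end{bmatrix}-\begin{bmatrix}\tilde s(t)\\\tilde z(t)\end{bmatrix}\right\|\le\beta(\|z_i(t_0)-\tilde z(t_0)\|,t-t_0)+\gamma\Big(\sup_{s\in[t_0,t)}\max\{d_{\mathcal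 G}\Psi(s),D(s)\}\,w(t-s)\Big)+d_{\mathcal G}\Psi(t).$$ Both estimates hold for all $t\ge t_0$ in the interval $[t_0,\omega)$, $\omega\le\infty$, on which the solution of the coupled system is considered; this includes maximal and global solutions. -/

import Mathlib

open Set Filter Topology MeasureTheory
open scoped Matrix

noncomputable section

/-! Vectors are functions on `Fin m` and stacked vectors are pairs or families of those, so that
`‖·‖` is the maximum norm throughout. -/

/-! ### Comparison functions -/

/-- Class `K∞`: continuous, strictly increasing, zero at zero and unbounded on `[0, ∞)`. -/
structure ClassKInf (α : ℝ → ℝ) : Prop where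
  continuousOn : ContinuousOn α (Ici 0)
  strictMonoOn : StrictMonoOn α (Ici 0)
  map_zero : α 0 = 0
  tendsto_atTop : Tendsto α atTop atTop

/-- Class `KL`: `β(·, t)` is continuous, strictly increasing and zero at zero for every `t ≥ 0`, and
`β(r, ·)` is decreasing with limit zero for every `r ≥ 0`. -/
structure ClassKL (β : ℝ → ℝ → ℝ) : Prop where
  continuousOn : ∀ t, 0 ≤ t → ContinuousOn (fun r => β r t) (Ici 0)
  strictMonoOn : ∀ t, 0 ≤ t → StrictMonoOn (fun r => β r t) (Ici 0)
  map_zero : ∀ t, 0 ≤ t → β 0 t = 0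
  antitoneOn : ∀ r, 0 ≤ r → AntitoneOn (β r) (Ici 0)
  tendsto_zero : ∀ r, 0 ≤ r → Tendsto (β r) atTop (𝓝 0)

/-- Decreasing functions `w : [0, ∞) → (0, 1]` with limit zero. -/
structure IsDecayWeight (w : ℝ → ℝ) : Prop where
  pos : ∀ t, 0 ≤ t → 0 < w t
  le_one : ∀ t, 0 ≤ t → w t ≤ 1
  antitoneOn : AntitoneOn w (Ici 0)
  tendsto_zero : Tendsto w atTop (𝓝 0)

/-! ### Differential equations, inputs and incremental input-to-state stability -/

/-- `x` is a Carathéodory solution of `ẋ(t) = f(t, x(t))` on the interval `[τ, ω)`, where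
`ω ≤ ∞`; the differential equation is written in its integrated form. -/
def IsCaratheodorySol {X : Type*} [NormedAddCommGroup X] [NormedSpace ℝ X]
    (f : ℝ → X → X) (τ : ℝ) (ω : EReal) (x : ℝ → X) : Prop :=
  ∀ t : ℝ, τ ≤ t → (t : EReal) < ω →
    IntervalIntegrable (fun s => f s (x s)) volume τ t ∧
      x t = x τ + ∫ s in τ..t, f s (x s)

/-- (Lebesgue) measurable, locally essentially bounded inputs on `[τ, ∞)`. -/
structure IsInput {U : Type*} [NormedAddCommGroup U] (τ : ℝ) (u : ℝ → U) : Prop where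
  aestronglyMeasurable : AEStronglyMeasurable u (volume.restrict (Ici τ))
  locallyEssBounded : ∀ T, τ ≤ T → ∃ C : ℝ, ∀ᵐ s ∂(volume.restrict (Icc τ T)), ‖u s‖ ≤ C

/-- The system `ẋ(t) = f(t, x(t), u(t))` on `[t₀, ∞)` is `δ`-ISS with `(β, γ)`: its solutions exist
globally, and they satisfy the incremental estimate, from every initial time `τ ≥ t₀`.  Where the
input difference is unbounded on `[τ, t)` the estimate says nothing (its supremum is `∞`). -/
structure DeltaISS {X U : Type*} [NormedAddCommGroup X] [NormedSpace ℝ X] [NormedAddCommGroup U]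
    (t₀ : ℝ) (f : ℝ → X → U → X) (β : ℝ → ℝ → ℝ) (γ : ℝ → ℝ) : Prop where
  classKL : ClassKL β
  classKInf : ClassKInf γ
  exists_sol : ∀ τ, t₀ ≤ τ → ∀ u : ℝ → U, IsInput τ u → ∀ x₀ : X,
    ∃ x : ℝ → X, x τ = x₀ ∧ IsCaratheodorySol (fun t x => f t x (u t)) τ ⊤ x
  estimate : ∀ τ, t₀ ≤ τ → ∀ u u' : ℝ → U, IsInput τ u → IsInput τ u' → ∀ x x' : ℝ → X,
    IsCaratheodorySol (fun t x => f t x (u t)) τ ⊤ x →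
    IsCaratheodorySol (fun t x => f t x (u' t)) τ ⊤ x' →
    ∀ t, τ ≤ t → BddAbove ((fun s => ‖u s - u' s‖) '' Ico τ t) →
      ‖x t - x' t‖ ≤
        β ‖x τ - x' τ‖ (t - τ) + γ (sSup ((fun s => ‖u s - u' s‖) '' Ico τ t))

/-! ### The multi-agent system -/

/-- The data of `N` agents with outputs in `ℝᵐ`, internal states in `ℝⁿ`, a common vector field `Z`
of the internal dynamics, and an edge-wise coupling over an undirected graph.  Agent `i` receives
from the agents adjacent to it; `μ i j p` and `ψ i j p` belong to the edge from `j` to `i`. -/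
structure AgentNetwork (N m n : ℕ) where
  t₀ : ℝ
  F : Fin N → ℝ → (Fin m → ℝ) → (Fin n → ℝ) → (Fin m → ℝ)
  Z : ℝ → (Fin n → ℝ) → (Fin m → ℝ) → (Fin n → ℝ)
  /-- dimensions of the introspective outputs -/
  k : Fin N → ℕ
  W : (i : Fin N) → (Fin m → ℝ) → (Fin n → ℝ) → (Fin (k i) → ℝ)
  Γ : (i : Fin N) → ℝ → (Fin (k i) → ℝ) → Matrix (Fin m) (Fin m) ℝ
  G : SimpleGraph (Fin N)
  ψ : Fin N → Fin N → Fin m → ℝ → ℝ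
  μ : Fin N → Fin N → Fin m → ℝ → ℝ

/-- Measurable in `t`, locally Lipschitz in the state, and bounded on every compact set of states
uniformly in `t ≥ t₀`. -/
structure IsRegularField {X Y : Type*} [NormedAddCommGroup X] [NormedAddCommGroup Y]
    (t₀ : ℝ) (f : ℝ → X → Y) : Prop where
  measurable : ∀ x, AEStronglyMeasurable (fun t => f t x) (volume.restrict (Ici t₀))
  locallyLipschitz : ∀ t, t₀ ≤ t → LocallyLipschitz (f t)
  bounded : ∀ K : Set X, IsCompact K → ∃ C : ℝ, ∀ t, t₀ ≤ t → ∀ x ∈ K, ‖f t x‖ ≤ C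

namespace AgentNetwork

variable {N m n : ℕ} (S : AgentNetwork N m n)

/-- Assumption on the open loop dynamics. -/
structure OpenLoop : Prop where
  F : ∀ i, IsRegularField S.t₀ (fun t (x : (Fin m → ℝ) × (Fin n → ℝ)) => S.F i t x.1 x.2)
  Z : IsRegularField S.t₀ (fun t (x : (Fin n → ℝ) × (Fin m → ℝ)) => S.Z t x.1 x.2)
  Γ : ∀ i, IsRegularField S.t₀
    (fun t (w : Fin (S.k i) → ℝ) => (fun a b => S.Γ i t w a b : Fin m → Fin m → ℝ))
  W : ∀ i, LocallyLipschitz (fun x : (Fin m → ℝ) × (Fin n → ℝ) => S.W i x.1 x.2)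

section
open scoped Matrix.Norms.Operator

/-- Assumption on the gain matrices; `‖·‖` is the matrix norm induced by the maximum norm. -/
structure GainMatrix : Prop where
  isUnit : ∀ i t, S.t₀ ≤ t → ∀ w, IsUnit (S.Γ i t w)
  inv_bounded : ∃ M : ℝ, 0 < M ∧ ∀ i t, S.t₀ ≤ t → ∀ w, ‖(S.Γ i t w)⁻¹‖ ≤ M

end

/-- Assumption on the performance functions `ψ` and the coupling functions `μ`. -/
structure DesignFunctions : Prop where
  ψ_pos : ∀ i j, S.G.Adj i j → ∀ p t, S.t₀ ≤ t → 0 < S.ψ i j p t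
  ψ_bounded : ∀ i j, S.G.Adj i j → ∀ p, ∃ C : ℝ, ∀ t, S.t₀ ≤ t → S.ψ i j p t ≤ C
  ψ_contDiffOn : ∀ i j, S.G.Adj i j → ∀ p, ContDiffOn ℝ 1 (S.ψ i j p) (Ici S.t₀)
  ψ_deriv_bounded : ∀ i j, S.G.Adj i j → ∀ p, ∃ C : ℝ, ∀ t, S.t₀ ≤ t →
    |derivWithin (S.ψ i j p) (Ici S.t₀) t| ≤ C
  ψ_symm : ∀ i j, S.G.Adj i j → ∀ p t, S.t₀ ≤ t → S.ψ i j p t = S.ψ j i p t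
  μ_continuousOn : ∀ i j, S.G.Adj i j → ∀ p, ContinuousOn (S.μ i j p) (Ioo (-1) 1)
  μ_tendsto_one : ∀ i j, S.G.Adj i j → ∀ p, Tendsto (S.μ i j p) (𝓝[<] 1) atTop
  μ_tendsto_neg_one : ∀ i j, S.G.Adj i j → ∀ p, Tendsto (S.μ i j p) (𝓝[>] (-1)) atBot
  μ_symm : ∀ i j, S.G.Adj i j → ∀ p, ∀ s ∈ Ioo (-1 : ℝ) 1, S.μ i j p (-s) = -S.μ j i p s

/-- `Ψ(t)`, the largest value of a performance function over all edges and components. -/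
def Psi (t : ℝ) : ℝ :=
  ⨆ q : {q : Fin N × Fin N × Fin m // S.G.Adj q.1 q.2.1}, S.ψ q.1.1 q.1.2.1 q.1.2.2 t

/-- `d_G Ψ(t)`, with `d_G` the diameter of the graph. -/
def funnelRadius (t : ℝ) : ℝ := (S.G.diam : ℝ) * S.Psi t

/-- The vector field of the perturbed blended dynamics with inputs `e₁, …, e_N`. -/
def perturbedBlended (t : ℝ) (x : (Fin m → ℝ) × (Fin N → Fin n → ℝ)) (e : Fin N → Fin m → ℝ) :
    (Fin m → ℝ) × (Fin N → Fin n → ℝ) :=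
  ((1 / (N : ℝ)) • ∑ i, S.F i t (x.1 + e i) (x.2 i), fun i => S.Z t (x.2 i) (x.1 + e i))

/-- No finite escape time of the perturbed blended dynamics. -/
def NoFiniteEscape : Prop :=
  ∀ τ, S.t₀ ≤ τ → ∀ e : ℝ → Fin N → Fin m → ℝ,
    (∀ i T, τ ≤ T → AbsolutelyContinuousOnInterval (fun t => e t i) τ T) →
    (∀ i t, τ ≤ t → ‖e t i‖ ≤ S.funnelRadius t) →
    ∀ x₀ : (Fin m → ℝ) × (Fin N → Fin n → ℝ), ∃ x : ℝ → (Fin m → ℝ) × (Fin N → Fin n → ℝ),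
      x τ = x₀ ∧ IsCaratheodorySol (fun t x => S.perturbedBlended t x (e t)) τ ⊤ x

open Classical in
/-- The edge-wise funnel coupling law `uᵢ`, as a function of time and all outputs. -/
def coupling (i : Fin N) (t : ℝ) (w : Fin (S.k i) → ℝ) (y : Fin N → Fin m → ℝ) : Fin m → ℝ :=
  (S.Γ i t w)⁻¹ *ᵥ
    ∑ j with S.G.Adj i j, (fun p => S.μ i j p ((y j p - y i p) / S.ψ i j p t) : Fin m → ℝ)

/-- The vector field of the agents under the funnel coupling; the state consists of all outputs and
all internal states. -/
def closedLoop (t : ℝ) (x : (Fin N → Fin m → ℝ) × (Fin N → Fin n → ℝ)) :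
    (Fin N → Fin m → ℝ) × (Fin N → Fin n → ℝ) :=
  (fun i => S.F i t (x.1 i) (x.2 i) +
      S.Γ i t (S.W i (x.1 i) (x.2 i)) *ᵥ S.coupling i t (S.W i (x.1 i) (x.2 i)) x.1,
    fun i => S.Z t (x.2 i) (x.1 i))

/-- `(y, z)` solves the closed loop on `[t₀, ω)`, where `ω ≤ ∞`.  The coupling functions live on
`(-1, 1)`, so the closed loop is only defined where `|yⱼᵖ - yᵢᵖ| < ψᵢⱼᵖ(t)` on all edges, and a
solution evolves there; in particular its initial value lies there. -/
structure IsClosedLoopSol (ω : EReal) (y : ℝ → Fin N → Fin m → ℝ) (z : ℝ → Fin N → Fin n → ℝ) :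
    Prop where
  mem_domain : ∀ t : ℝ, S.t₀ ≤ t → (t : EReal) < ω → ∀ i j, S.G.Adj i j → ∀ p,
    |y t j p - y t i p| < S.ψ i j p t
  sol : IsCaratheodorySol S.closedLoop S.t₀ ω (fun t => (y t, z t))

/-- The vector field of the reduced order blended dynamics. -/
def reducedBlended (t : ℝ) (x : (Fin m → ℝ) × (Fin n → ℝ)) : (Fin m → ℝ) × (Fin n → ℝ) :=
  ((1 / (N : ℝ)) • ∑ i, S.F i t x.1 x.2, S.Z t x.2 x.1)

/-- The vector field of the perturbed reduced order blended dynamics with input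
`(e₀, (e₁, …, e_N), (d₁, …, d_N))`. -/
def perturbedReduced (t : ℝ) (x : (Fin m → ℝ) × (Fin n → ℝ))
    (u : (Fin m → ℝ) × (Fin N → Fin m → ℝ) × (Fin N → Fin n → ℝ)) :
    (Fin m → ℝ) × (Fin n → ℝ) :=
  ((1 / (N : ℝ)) • ∑ i, S.F i t (x.1 + u.2.1 i) (x.2 + u.2.2 i), S.Z t x.2 (x.1 + u.1))

/-- `D(t)` for the initial internal states `z₁(t₀), …, z_N(t₀)`. -/
def D (βt : ℝ → ℝ → ℝ) (γt wt : ℝ → ℝ) (z₀ : Fin N → Fin n → ℝ) (t : ℝ) : ℝ :=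
  (⨆ q : Fin N × Fin N, βt ‖z₀ q.2 - z₀ q.1‖ (t - S.t₀)) +
    γt (sSup ((fun s => S.funnelRadius s * wt (t - s)) '' Ico S.t₀ t))

/-- `D` bounds all differences of internal states, along every solution of the closed loop whose
initial internal states differ by at most `M`. -/
def DBoundsInternal (M : ℝ) (βt : ℝ → ℝ → ℝ) (γt wt : ℝ → ℝ) : Prop :=
  ∀ ω y z, S.IsClosedLoopSol ω y z → (∀ i j, ‖z S.t₀ j - z S.t₀ i‖ ≤ M) →
    ∀ t : ℝ, S.t₀ ≤ t → (t : EReal) < ω → ∀ i j,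
      ‖z t j - z t i‖ ≤ S.D βt γt wt (z S.t₀) t

end AgentNetwork

end

/-! The mean of all outputs, together with the internal state of any one agent, solves the perturbed
reduced order blended dynamics: the coupling terms cancel in the mean, and the inputs are the
deviations from the mean, which are at most `max (d_G Ψ) D`.

It remains to discount past inputs in a `δ`-ISS estimate.  Let `ρ ≤ R` bound the input difference
and let `v` be the supremum of `ρ(s) w(T - s)` over `[τ, T)`.  The estimate on `[τ, T - L]` gives an
a priori bound `K = β(M, 0) + γ(R)` on the state difference at time `T - L`, and on `[T - L, T)` one
has `ρ ≤ v / w(L)`; restarting at `T - L` therefore bounds the state difference at `T` by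
`β(K, L) + γ(v / w(L))`.  The infimum over `L ≥ 0` is monotone in `v` and tends to zero with `v`, so
it has a majorant of class `K∞`, which is the required gain. -/

/-! ### Majorants of class `K∞` -/

section ComparisonFunctions

variable {γ : ℝ → ℝ} {β : ℝ → ℝ → ℝ}

lemma ClassKInf.monotoneOn (hγ : ClassKInf γ) : MonotoneOn γ (Ici 0) :=
  hγ.strictMonoOn.monotoneOn

lemma ClassKInf.nonneg (hγ : ClassKInf γ) {a : ℝ} (ha : 0 ≤ a) : 0 ≤ γ a :=
  hγ.map_zero ▸ hγ.monotoneOn self_mem_Ici ha ha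

lemma ClassKL.monotoneOn (hβ : ClassKL β) {t : ℝ} (ht : 0 ≤ t) :
    MonotoneOn (fun r => β r t) (Ici 0) :=
  (hβ.strictMonoOn t ht).monotoneOn

lemma ClassKL.nonneg (hβ : ClassKL β) {r t : ℝ} (hr : 0 ≤ r) (ht : 0 ≤ t) : 0 ≤ β r t :=
  hβ.map_zero t ht ▸ hβ.monotoneOn ht self_mem_Ici hr hr

lemma ClassKL.le_apply_zero (hβ : ClassKL β) {r M t : ℝ} (hr : 0 ≤ r) (hrM : r ≤ M) (ht : 0 ≤ t) :
    β r t ≤ β M 0 :=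
  (hβ.antitoneOn r hr self_mem_Ici ht ht).trans
    (hβ.monotoneOn le_rfl hr (mem_Ici.2 (hr.trans hrM)) hrM)

end ComparisonFunctions

/-- The mean of `g` over `[v, 2v]`, a continuous majorant of a monotone function `g`.  The integral
is rescaled to `[1, 2]` so that `v = 0` is not exceptional. -/
noncomputable def dilationMean (g : ℝ → ℝ) (v : ℝ) : ℝ :=
  ∫ s in (1 : ℝ)..2, g (v * s)

section DilationMean

variable {g : ℝ → ℝ} {v : ℝ}

lemma intervalIntegrable_dilation (hg : MonotoneOn g (Ici 0)) (hv : 0 ≤ v) :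
    IntervalIntegrable (fun s => g (v * s)) volume 1 2 := by
  refine MonotoneOn.intervalIntegrable fun s hs t ht hst => ?_
  rw [uIcc_of_le one_le_two] at hs ht
  exact hg (mul_nonneg hv (zero_le_one.trans hs.1)) (mul_nonneg hv (zero_le_one.trans ht.1))
    (mul_le_mul_of_nonneg_left hst hv)

lemma le_dilationMean (hg : MonotoneOn g (Ici 0)) (hv : 0 ≤ v) : g v ≤ dilationMean g v := by
  have h := intervalIntegral.integral_mono_on one_le_two (intervalIntegrable_const (c := g v))
    (intervalIntegrable_dilation hg hv) fun s hs =>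
      hg hv (mul_nonneg hv (zero_le_one.trans hs.1)) (le_mul_of_one_le_right hv hs.1)
  simpa [dilationMean, show (2 : ℝ) - 1 = 1 by norm_num] using h

lemma dilationMean_le (hg : MonotoneOn g (Ici 0)) (hv : 0 ≤ v) :
    dilationMean g v ≤ g (v * 2) := by
  have h := intervalIntegral.integral_mono_on one_le_two (intervalIntegrable_dilation hg hv)
    (intervalIntegrable_const (c := g (v * 2))) fun s hs =>
      hg (mul_nonneg hv (zero_le_one.trans hs.1)) (mul_nonneg hv zero_le_two)
        (mul_le_mul_of_nonneg_left hs.2 hv)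
  simpa [dilationMean, show (2 : ℝ) - 1 = 1 by norm_num] using h

lemma monotoneOn_dilationMean (hg : MonotoneOn g (Ici 0)) :
    MonotoneOn (dilationMean g) (Ici 0) := fun _ ha _ hb hab =>
  intervalIntegral.integral_mono_on one_le_two (intervalIntegrable_dilation hg ha)
    (intervalIntegrable_dilation hg hb) fun _ hs =>
      have hs := zero_le_one.trans hs.1
      hg (mul_nonneg ha hs) (mul_nonneg hb hs) (mul_le_mul_of_nonneg_right hab hs)

lemma continuousAt_dilationMean (hg : MonotoneOn g (Ici 0)) (hv : 0 < v) :
    ContinuousAt (dilationMean g) v := by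
  have hint : ∀ x, 0 ≤ x → IntervalIntegrable g volume 0 x := fun x hx =>
    MonotoneOn.intervalIntegrable (hg.mono (uIcc_of_le hx ▸ Icc_subset_Ici_self))
  have hprim : ∀ x, 0 < x → ContinuousAt (fun x => ∫ s in (0 : ℝ)..x, g s) x := by
    intro x hx
    have h := intervalIntegral.continuousOn_primitive_interval' (hint (x + 1) (by positivity))
      left_mem_uIcc
    rw [uIcc_of_le (by positivity)] at h
    exact h.continuousAt (Icc_mem_nhds hx (lt_add_one x))
  have hprim_double : ContinuousAt (fun x : ℝ => ∫ s in (0 : ℝ)..(x * 2), g s) v :=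
    ContinuousAt.comp (f := fun x : ℝ => x * 2) (hprim (v * 2) (by positivity)) (by fun_prop)
  have hquot : ContinuousAt (fun x : ℝ =>
      x⁻¹ * ((∫ s in (0 : ℝ)..(x * 2), g s) - ∫ s in (0 : ℝ)..x, g s)) v :=
    (continuousAt_inv₀ hv.ne').mul (hprim_double.sub (hprim v hv))
  refine hquot.congr ?_
  filter_upwards [lt_mem_nhds hv] with x hx
  rw [intervalIntegral.integral_interval_sub_left (hint _ (by positivity)) (hint x hx.le),
    dilationMean, intervalIntegral.integral_comp_mul_left g hx.ne', mul_one, smul_eq_mul]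

lemma tendsto_dilationMean (hg : MonotoneOn g (Ici 0)) {a : ℝ} (h0 : Tendsto g (𝓝[≥] 0) (𝓝 a)) :
    Tendsto (dilationMean g) (𝓝[≥] 0) (𝓝 a) := by
  have hdouble : Tendsto (fun v : ℝ => v * 2) (𝓝[≥] 0) (𝓝[≥] 0) := by
    refine tendsto_nhdsWithin_iff.2 ⟨tendsto_nhdsWithin_of_tendsto_nhds ?_, ?_⟩
    · simpa using (continuous_mul_const (2 : ℝ)).tendsto 0
    · filter_upwards [self_mem_nhdsWithin] with v hv using mul_nonneg (mem_Ici.1 hv) zero_le_two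
  refine tendsto_of_tendsto_of_tendsto_of_le_of_le' h0 (h0.comp hdouble) ?_ ?_
  · filter_upwards [self_mem_nhdsWithin] with v hv using le_dilationMean hg hv
  · filter_upwards [self_mem_nhdsWithin] with v hv using dilationMean_le hg hv

lemma continuousOn_dilationMean (hg : MonotoneOn g (Ici 0))
    (h0 : ContinuousWithinAt g (Ici 0) 0) : ContinuousOn (dilationMean g) (Ici 0) := by
  intro v hv
  rcases (mem_Ici.1 hv).eq_or_lt with rfl | hv
  · have hzero : dilationMean g 0 = g 0 := by simp [dilationMean, show (2 : ℝ) - 1 = 1 by norm_num]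
    rw [ContinuousWithinAt, hzero]
    exact tendsto_dilationMean hg h0
  · exact (continuousAt_dilationMean hg hv).continuousWithinAt

/-- The identity is added to the mean to make the majorant strictly increasing and unbounded. -/
theorem exists_classKInf_ge (hg : MonotoneOn g (Ici 0)) (h0 : Tendsto g (𝓝[≥] 0) (𝓝 0)) :
    ∃ γ : ℝ → ℝ, ClassKInf γ ∧ ∀ v, 0 ≤ v → g v ≤ γ v := by
  have hg0 : g 0 = 0 :=
    tendsto_nhds_unique (tendsto_pure_nhds g 0) (h0.mono_left (pure_le_nhdsWithin self_mem_Ici))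
  have hnonneg : ∀ v, 0 ≤ v → 0 ≤ dilationMean g v := fun v hv =>
    (hg0 ▸ hg self_mem_Ici hv hv).trans (le_dilationMean hg hv)
  refine ⟨fun v => dilationMean g v + v, ⟨?_, ?_, ?_, ?_⟩, fun v hv => ?_⟩
  · have hcont : ContinuousWithinAt g (Ici 0) 0 := by rwa [ContinuousWithinAt, hg0]
    exact (continuousOn_dilationMean hg hcont).add continuousOn_id
  · exact (monotoneOn_dilationMean hg).add_strictMono (strictMono_id.strictMonoOn _)
  · simp [dilationMean, hg0]
  · refine tendsto_atTop_mono' atTop ?_ tendsto_id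
    filter_upwards [eventually_ge_atTop 0] with v hv
    exact le_add_of_nonneg_left (hnonneg v hv)
  · exact (le_dilationMean hg hv).trans (le_add_of_nonneg_right hv)

end DilationMean

/-! ### Gains with fading memory -/

/-- The best of the bounds `β(K, L) + γ(v / w(L))` obtained by restarting an incremental estimate a
time `L` before the present, where `K` bounds the state difference at the restart and `v` is the
weighted supremum of the input difference. -/
noncomputable def fadingGain (β : ℝ → ℝ → ℝ) (γ w : ℝ → ℝ) (K v : ℝ) : ℝ :=
  ⨅ L : Ici (0 : ℝ), (β K L + γ (v / w L))

section FadingGain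

variable {β : ℝ → ℝ → ℝ} {γ w : ℝ → ℝ} {K v : ℝ}

lemma restartBound_nonneg (hβ : ClassKL β) (hγ : ClassKInf γ) (hw : ∀ L, 0 ≤ L → 0 < w L)
    (hK : 0 ≤ K) (hv : 0 ≤ v) (L : Ici (0 : ℝ)) : 0 ≤ β K L + γ (v / w L) :=
  add_nonneg (hβ.nonneg hK L.2) (hγ.nonneg (div_nonneg hv (hw L L.2).le))

lemma fadingGain_le (hβ : ClassKL β) (hγ : ClassKInf γ) (hw : ∀ L, 0 ≤ L → 0 < w L) (hK : 0 ≤ K)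
    (hv : 0 ≤ v) {L : ℝ} (hL : 0 ≤ L) : fadingGain β γ w K v ≤ β K L + γ (v / w L) :=
  ciInf_le (f := fun L : Ici (0 : ℝ) => β K L + γ (v / w L))
    ⟨0, forall_mem_range.2 (restartBound_nonneg hβ hγ hw hK hv)⟩ ⟨L, hL⟩

lemma le_fadingGain {a : ℝ} (h : ∀ L, 0 ≤ L → a ≤ β K L + γ (v / w L)) :
    a ≤ fadingGain β γ w K v :=
  le_ciInf fun L => h L L.2

lemma monotoneOn_fadingGain (hβ : ClassKL β) (hγ : ClassKInf γ) (hw : ∀ L, 0 ≤ L → 0 < w L)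
    (hK : 0 ≤ K) : MonotoneOn (fadingGain β γ w K) (Ici 0) := fun _ hv _ hv' hvv' =>
  le_fadingGain fun L hL => (fadingGain_le hβ hγ hw hK hv hL).trans <|
    add_le_add_right (hγ.monotoneOn (div_nonneg hv (hw L hL).le) (div_nonneg hv' (hw L hL).le)
      (div_le_div_of_nonneg_right hvv' (hw L hL).le)) _

lemma tendsto_fadingGain (hβ : ClassKL β) (hγ : ClassKInf γ) (hw : ∀ L, 0 ≤ L → 0 < w L)
    (hK : 0 ≤ K) : Tendsto (fadingGain β γ w K) (𝓝[≥] 0) (𝓝 0) := by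
  refine tendsto_order.2 ⟨fun a ha => ?_, fun ε hε => ?_⟩
  · filter_upwards [self_mem_nhdsWithin] with v hv
    exact ha.trans_le (le_fadingGain fun L hL => restartBound_nonneg hβ hγ hw hK hv ⟨L, hL⟩)
  · obtain ⟨L, hLε, hL⟩ := (((hβ.tendsto_zero K hK).eventually_lt_const hε).and
      (eventually_ge_atTop 0)).exists
    have hdiv : Tendsto (fun v => v / w L) (𝓝[≥] 0) (𝓝[≥] 0) := by
      refine tendsto_nhdsWithin_iff.2 ⟨tendsto_nhdsWithin_of_tendsto_nhds ?_, ?_⟩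
      · simpa using (continuous_id.div_const (w L)).tendsto 0
      · filter_upwards [self_mem_nhdsWithin] with v hv using div_nonneg hv (hw L hL).le
    have hγ0 : Tendsto γ (𝓝[≥] 0) (𝓝 0) := by
      simpa only [ContinuousWithinAt, hγ.map_zero] using hγ.continuousOn 0 self_mem_Ici
    have hlim : Tendsto (fun v => β K L + γ (v / w L)) (𝓝[≥] 0) (𝓝 (β K L)) := by
      simpa using (hγ0.comp hdiv).const_add (β K L)
    filter_upwards [hlim.eventually_lt_const hLε, self_mem_nhdsWithin] with v hvε hv
    exact (fadingGain_le hβ hγ hw hK hv hL).trans_lt hvε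

theorem exists_classKInf_ge_fadingGain (hβ : ClassKL β) (hγ : ClassKInf γ)
    (hw : ∀ L, 0 ≤ L → 0 < w L) (hK : 0 ≤ K) :
    ∃ γ' : ℝ → ℝ, ClassKInf γ' ∧ ∀ v, 0 ≤ v → fadingGain β γ w K v ≤ γ' v :=
  exists_classKInf_ge (monotoneOn_fadingGain hβ hγ hw hK) (tendsto_fadingGain hβ hγ hw hK)

end FadingGain

/-- The supremum over `s ∈ [τ, T)` of `ρ(s)`, discounted by `w` of the elapsed time `T - s`. -/
noncomputable def weightedSup (ρ w : ℝ → ℝ) (τ T : ℝ) : ℝ :=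
  sSup ((fun s => ρ s * w (T - s)) '' Ico τ T)

section WeightedSup

variable {ρ w : ℝ → ℝ} {τ T R : ℝ}

lemma weightedSup_nonneg (hw : IsDecayWeight w) (hρ : ∀ s ∈ Ico τ T, 0 ≤ ρ s) :
    0 ≤ weightedSup ρ w τ T :=
  Real.sSup_nonneg <| forall_mem_image.2 fun s hs =>
    mul_nonneg (hρ s hs) (hw.pos _ (sub_nonneg.2 hs.2.le)).le

lemma mul_weight_le (hw : IsDecayWeight w) (hρ : ∀ s ∈ Ico τ T, 0 ≤ ρ s)
    (hR : ∀ s ∈ Ico τ T, ρ s ≤ R) {s : ℝ} (hs : s ∈ Ico τ T) : ρ s * w (T - s) ≤ R :=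
  (mul_le_of_le_one_right (hρ s hs) (hw.le_one _ (sub_nonneg.2 hs.2.le))).trans (hR s hs)

lemma weightedSup_le (hw : IsDecayWeight w) (hρ : ∀ s ∈ Ico τ T, 0 ≤ ρ s)
    (hR : ∀ s ∈ Ico τ T, ρ s ≤ R) (hR0 : 0 ≤ R) : weightedSup ρ w τ T ≤ R :=
  Real.sSup_le (forall_mem_image.2 fun _ => mul_weight_le hw hρ hR) hR0

lemma le_weightedSup_div (hw : IsDecayWeight w) (hρ : ∀ s ∈ Ico τ T, 0 ≤ ρ s)
    (hR : ∀ s ∈ Ico τ T, ρ s ≤ R) {L s : ℝ} (hs : s ∈ Ico τ T) (hL : 0 ≤ L) (hLs : T - L ≤ s) :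
    ρ s ≤ weightedSup ρ w τ T / w L := by
  rw [le_div_iff₀ (hw.pos L hL)]
  calc ρ s * w L ≤ ρ s * w (T - s) := mul_le_mul_of_nonneg_left
        (hw.antitoneOn (sub_nonneg.2 hs.2.le) hL (by linarith)) (hρ s hs)
    _ ≤ weightedSup ρ w τ T :=
        le_csSup ⟨R, forall_mem_image.2 fun _ => mul_weight_le hw hρ hR⟩ ⟨s, hs, rfl⟩

end WeightedSup

/-! ### Solutions on compact intervals -/

/-- `x` is a Carathéodory solution of `ẋ(t) = f(t, x(t))` on the compact interval `[τ, T]`.  Closed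
loop solutions may escape in finite time, so incremental estimates are applied to their restrictions
to such intervals. -/
def IsSolOn {X : Type*} [NormedAddCommGroup X] [NormedSpace ℝ X]
    (f : ℝ → X → X) (τ T : ℝ) (x : ℝ → X) : Prop :=
  ∀ t ∈ Icc τ T, IntervalIntegrable (fun s => f s (x s)) volume τ t ∧
    x t = x τ + ∫ s in τ..t, f s (x s)

section Solutions

variable {X Y : Type*} [NormedAddCommGroup X] [NormedSpace ℝ X] [NormedAddCommGroup Y]
  [NormedSpace ℝ Y] {f f' : ℝ → X → X} {τ σ T : ℝ} {x x' : ℝ → X}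

lemma IsCaratheodorySol.isSolOn {ω : EReal} (h : IsCaratheodorySol f τ ω x)
    (hT : (T : EReal) < ω) : IsSolOn f τ T x :=
  fun t ht => h t ht.1 ((EReal.coe_le_coe_iff.2 ht.2).trans_lt hT)

lemma isCaratheodorySol_top_iff : IsCaratheodorySol f τ ⊤ x ↔ ∀ T, IsSolOn f τ T x :=
  ⟨fun h T => h.isSolOn (EReal.coe_lt_top T), fun h t ht _ => h t t ⟨ht, le_rfl⟩⟩

namespace IsSolOn

lemma restrict_left (h : IsSolOn f τ T x) (hσ : σ ≤ T) : IsSolOn f τ σ x :=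
  fun t ht => h t ⟨ht.1, ht.2.trans hσ⟩

lemma restrict_right (h : IsSolOn f τ T x) (hσ : σ ∈ Icc τ T) : IsSolOn f σ T x := by
  intro t ht
  obtain ⟨hiσ, hxσ⟩ := h σ hσ
  obtain ⟨hit, hxt⟩ := h t ⟨hσ.1.trans ht.1, ht.2⟩
  refine ⟨hiσ.symm.trans hit, ?_⟩
  rw [hxt, hxσ, add_assoc,
    intervalIntegral.integral_add_adjacent_intervals hiσ (hiσ.symm.trans hit)]

lemma trans (h : IsSolOn f τ σ x) (h' : IsSolOn f σ T x) (hσ : τ ≤ σ) : IsSolOn f τ T x := by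
  intro t ht
  rcases le_total t σ with htσ | htσ
  · exact h t ⟨ht.1, htσ⟩
  · obtain ⟨hiσ, hxσ⟩ := h σ ⟨hσ, le_rfl⟩
    obtain ⟨hit, hxt⟩ := h' t ⟨htσ, ht.2⟩
    refine ⟨hiσ.trans hit, ?_⟩
    rw [hxt, hxσ, add_assoc, intervalIntegral.integral_add_adjacent_intervals hiσ hit]

lemma congr (h : IsSolOn f τ T x) (hx : EqOn x x' (Icc τ T))
    (hf : ∀ t ∈ Icc τ T, f t (x t) = f' t (x' t)) : IsSolOn f' τ T x' := by
  intro t ht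
  have heq : EqOn (fun s => f s (x s)) (fun s => f' s (x' s)) (uIcc τ t) := by
    rw [uIcc_of_le ht.1]
    exact fun s hs => hf s ⟨hs.1, hs.2.trans ht.2⟩
  refine ⟨(h t ht).1.congr (heq.mono uIoc_subset_uIcc), ?_⟩
  rw [← intervalIntegral.integral_congr heq, ← hx ht, ← hx ⟨le_rfl, ht.1.trans ht.2⟩]
  exact (h t ht).2

lemma map [CompleteSpace X] [CompleteSpace Y] (A : X →L[ℝ] Y) {g : ℝ → Y → Y}
    (h : IsSolOn f τ T x) (hg : ∀ t ∈ Icc τ T, A (f t (x t)) = g t (A (x t))) :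
    IsSolOn g τ T (fun t => A (x t)) := by
  have himage : IsSolOn (fun t _ => A (f t (x t))) τ T (fun t => A (x t)) := fun t ht => by
    obtain ⟨hi, hxt⟩ := h t ht
    refine ⟨⟨A.integrable_comp hi.1, A.integrable_comp hi.2⟩, ?_⟩
    rw [A.intervalIntegral_comp_comm hi, ← map_add, ← hxt]
  exact himage.congr (fun _ _ => rfl) hg

lemma continuousOn (h : IsSolOn f τ T x) : ContinuousOn x (Icc τ T) := by
  rcases lt_or_ge T τ with hT | hT
  · simp [Icc_eq_empty hT.not_ge]
  have hcont : ContinuousOn (fun t => x τ + ∫ s in τ..t, f s (x s)) (Icc τ T) := by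
    rw [← uIcc_of_le hT]
    exact continuousOn_const.add
      (intervalIntegral.continuousOn_primitive_interval' (h T ⟨hT, le_rfl⟩).1 left_mem_uIcc)
  exact hcont.congr fun t ht => (h t ht).2

end IsSolOn

end Solutions

/-! ### Incremental estimates with fading memory -/

lemma isInput_indicator {U : Type*} [NormedAddCommGroup U] {K : Set ℝ} (hK : IsCompact K)
    {u : ℝ → U} (hu : ContinuousOn u K) (τ : ℝ) : IsInput τ (K.indicator u) where
  aestronglyMeasurable := ((aestronglyMeasurable_indicator_iff hK.measurableSet).2
    (hu.aestronglyMeasurable_of_isCompact hK hK.measurableSet)).restrict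
  locallyEssBounded _ _ := by
    obtain ⟨C, hC⟩ := hK.exists_bound_of_continuousOn hu
    refine ⟨max C 0, Eventually.of_forall fun s => ?_⟩
    by_cases hs : s ∈ K
    · exact indicator_of_mem hs u ▸ (hC s hs).trans (le_max_left C 0)
    · simp [indicator_of_notMem hs]

namespace DeltaISS

variable {X U : Type*} [NormedAddCommGroup X] [NormedSpace ℝ X] [NormedAddCommGroup U]
  {t₀ τ T : ℝ} {f : ℝ → X → U → X} {β : ℝ → ℝ → ℝ} {γ : ℝ → ℝ} {u u' : ℝ → U} {x x' : ℝ → X}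

lemma exists_extension (hf : DeltaISS t₀ f β γ) (hτ : t₀ ≤ τ) (hT : τ ≤ T)
    (hu : ContinuousOn u (Icc τ T)) (hx : IsSolOn (fun t x => f t x (u t)) τ T x) :
    ∃ x' : ℝ → X, EqOn x x' (Icc τ T) ∧
      IsCaratheodorySol (fun t x => f t x ((Icc τ T).indicator u t)) τ ⊤ x' := by
  obtain ⟨y, hyT, hy⟩ :=
    hf.exists_sol T (hτ.trans hT) _ (isInput_indicator isCompact_Icc hu T) (x T)
  let x' : ℝ → X := (Iic T).piecewise x y
  have hleft : EqOn x x' (Icc τ T) := fun s hs => (piecewise_eq_of_mem (Iic T) x y hs.2).symm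
  have hright : EqOn y x' (Ici T) := by
    intro s hs
    rcases (mem_Ici.1 hs).eq_or_lt with rfl | hs
    · exact hyT.trans (hleft ⟨hT, le_rfl⟩)
    · exact (piecewise_eq_of_notMem (Iic T) x y hs.not_ge).symm
  refine ⟨x', hleft, isCaratheodorySol_top_iff.2 fun T' => IsSolOn.trans (σ := T) ?_ ?_ hT⟩
  · exact hx.congr hleft fun t ht => by simp only [hleft ht, indicator_of_mem ht]
  · exact (isCaratheodorySol_top_iff.1 hy T').congr (hright.mono Icc_subset_Ici_self)
      fun t ht => by simp only [hright ht.1]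

lemma estimate_on (hf : DeltaISS t₀ f β γ) (hτ : t₀ ≤ τ) (hT : τ ≤ T)
    (hu : ContinuousOn u (Icc τ T)) (hu' : ContinuousOn u' (Icc τ T))
    (hx : IsSolOn (fun t x => f t x (u t)) τ T x)
    (hx' : IsSolOn (fun t x => f t x (u' t)) τ T x') {c : ℝ} (hc : 0 ≤ c)
    (huc : ∀ s ∈ Ico τ T, ‖u s - u' s‖ ≤ c) :
    ‖x T - x' T‖ ≤ β ‖x τ - x' τ‖ (T - τ) + γ c := by
  obtain ⟨y, hxy, hy⟩ := hf.exists_extension hτ hT hu hx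
  obtain ⟨y', hxy', hy'⟩ := hf.exists_extension hτ hT hu' hx'
  have hle : ∀ a ∈ (fun s => ‖(Icc τ T).indicator u s - (Icc τ T).indicator u' s‖) '' Ico τ T,
      a ≤ c := forall_mem_image.2 fun s hs => by
    simpa only [indicator_of_mem (Ico_subset_Icc_self hs)] using huc s hs
  have hest := hf.estimate τ hτ _ _ (isInput_indicator isCompact_Icc hu τ)
    (isInput_indicator isCompact_Icc hu' τ) y y' hy hy' T hT ⟨c, hle⟩
  rw [← hxy ⟨hT, le_rfl⟩, ← hxy' ⟨hT, le_rfl⟩, ← hxy ⟨le_rfl, hT⟩, ← hxy' ⟨le_rfl, hT⟩] at hest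
  refine hest.trans (add_le_add_right (hf.classKInf.monotoneOn ?_ hc (Real.sSup_le hle hc)) _)
  exact Real.sSup_nonneg (forall_mem_image.2 fun s _ => norm_nonneg _)

/-- Restarting at `T - L`: only the inputs of the last `L` units of time enter the second gain. -/
lemma estimate_restart (hf : DeltaISS t₀ f β γ) (hτ : t₀ ≤ τ) (hT : τ ≤ T)
    (hu : ContinuousOn u (Icc τ T)) (hu' : ContinuousOn u' (Icc τ T))
    (hx : IsSolOn (fun t x => f t x (u t)) τ T x)
    (hx' : IsSolOn (fun t x => f t x (u' t)) τ T x') {M R c L : ℝ} (hM : ‖x τ - x' τ‖ ≤ M)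
    (hR : 0 ≤ R) (huR : ∀ s ∈ Ico τ T, ‖u s - u' s‖ ≤ R) (hL : 0 ≤ L) (hc : 0 ≤ c)
    (huc : ∀ s ∈ Ico τ T, T - L ≤ s → ‖u s - u' s‖ ≤ c) :
    ‖x T - x' T‖ ≤ β ‖x τ - x' τ‖ (T - τ) + (β (β M 0 + γ R) L + γ c) := by
  have hβ := hf.classKL
  have hK : 0 ≤ β M 0 + γ R :=
    add_nonneg (hβ.nonneg ((norm_nonneg _).trans hM) le_rfl) (hf.classKInf.nonneg hR)
  rcases le_total (T - τ) L with hTL | hTL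
  · have hest := hf.estimate_on hτ hT hu hu' hx hx' hc fun s hs =>
      huc s hs (by linarith [hs.1])
    linarith [hβ.nonneg hK hL]
  · have hσ : T - L ∈ Icc τ T := ⟨by linarith, by linarith⟩
    have hbefore := hf.estimate_on hτ hσ.1 (hu.mono (Icc_subset_Icc_right hσ.2))
      (hu'.mono (Icc_subset_Icc_right hσ.2)) (hx.restrict_left hσ.2) (hx'.restrict_left hσ.2) hR
      fun s hs => huR s ⟨hs.1, hs.2.trans_le hσ.2⟩
    have hrestart : ‖x (T - L) - x' (T - L)‖ ≤ β M 0 + γ R := hbefore.trans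
      (add_le_add_left (hβ.le_apply_zero (norm_nonneg _) hM (sub_nonneg.2 hσ.1)) _)
    have hafter := hf.estimate_on (hτ.trans hσ.1) hσ.2 (hu.mono (Icc_subset_Icc_left hσ.1))
      (hu'.mono (Icc_subset_Icc_left hσ.1)) (hx.restrict_right hσ) (hx'.restrict_right hσ) hc
      fun s hs => huc s ⟨hσ.1.trans hs.1, hs.2⟩ hs.1
    rw [sub_sub_cancel] at hafter
    linarith [hβ.monotoneOn hL (norm_nonneg _) hK hrestart,
      hβ.nonneg (norm_nonneg (x τ - x' τ)) (sub_nonneg.2 hT)]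

theorem estimate_weightedSup (hf : DeltaISS t₀ f β γ) (hτ : t₀ ≤ τ) (hT : τ ≤ T)
    (hu : ContinuousOn u (Icc τ T)) (hu' : ContinuousOn u' (Icc τ T))
    (hx : IsSolOn (fun t x => f t x (u t)) τ T x)
    (hx' : IsSolOn (fun t x => f t x (u' t)) τ T x') {w ρ : ℝ → ℝ} (hw : IsDecayWeight w)
    {M R : ℝ} (hM : ‖x τ - x' τ‖ ≤ M) (hR : 0 ≤ R)
    (huρ : ∀ s ∈ Ico τ T, ‖u s - u' s‖ ≤ ρ s) (hρR : ∀ s ∈ Ico τ T, ρ s ≤ R) :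
    ‖x T - x' T‖ ≤
      β ‖x τ - x' τ‖ (T - τ) + fadingGain β γ w (β M 0 + γ R) (weightedSup ρ w τ T) := by
  have hρ : ∀ s ∈ Ico τ T, 0 ≤ ρ s := fun s hs => (norm_nonneg _).trans (huρ s hs)
  rw [← sub_le_iff_le_add']
  refine le_fadingGain fun L hL => sub_le_iff_le_add'.2 ?_
  exact hf.estimate_restart hτ hT hu hu' hx hx' hM hR
    (fun s hs => (huρ s hs).trans (hρR s hs)) hL
    (div_nonneg (weightedSup_nonneg hw hρ) (hw.pos L hL).le) fun s hs hLs =>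
      (huρ s hs).trans (le_weightedSup_div hw hρ hρR hs hL hLs)

end DeltaISS

/-! ### Averages and graphs -/

section Average

variable {ι E : Type*} [Fintype ι] [NormedAddCommGroup E] [NormedSpace ℝ E]

/-- The arithmetic mean of a family of vectors, as a continuous linear map: it carries closed loop
solutions to solutions of the averaged dynamics. -/
noncomputable def arithMean : (ι → E) →L[ℝ] E :=
  (1 / (Fintype.card ι : ℝ)) • ∑ i, ContinuousLinearMap.proj i

lemma arithMean_apply (v : ι → E) : arithMean v = (1 / (Fintype.card ι : ℝ)) • ∑ i, v i := by
  simp [arithMean]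

lemma arithMean_fin_apply {N : ℕ} (v : Fin N → E) :
    arithMean v = (1 / (N : ℝ)) • ∑ i, v i := by
  rw [arithMean_apply, Fintype.card_fin]

lemma arithMean_mem [Nonempty ι] {s : Set E} (hs : Convex ℝ s) {v : ι → E} (hv : ∀ i, v i ∈ s) :
    arithMean v ∈ s := by
  rw [arithMean_apply, Finset.smul_sum]
  exact hs.sum_mem (fun _ _ => by positivity) (by simp) fun i _ => hv i

lemma norm_sub_arithMean_le [Nonempty ι] {v : ι → E} {a : E} {r : ℝ} (h : ∀ i, ‖a - v i‖ ≤ r) :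
    ‖a - arithMean v‖ ≤ r := by
  rw [← mem_closedBall_iff_norm']
  exact arithMean_mem (convex_closedBall a r) fun i => mem_closedBall_iff_norm'.2 (h i)

end Average

lemma sum_sum_eq_zero_of_antisymm {ι E : Type*} [Fintype ι] [AddCommGroup E]
    [IsAddTorsionFree E] {A : ι → ι → E} (hA : ∀ i j, A i j = -A j i) : ∑ i, ∑ j, A i j = 0 := by
  refine self_eq_neg.1 ?_
  calc ∑ i, ∑ j, A i j = ∑ j, ∑ i, A i j := Finset.sum_comm
    _ = -∑ j, ∑ i, A j i := by simp only [← Finset.sum_neg_distrib, ← hA]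

section Graph

variable {V E : Type*} [PseudoMetricSpace E] {G : SimpleGraph V} {y : V → E} {r : ℝ}

lemma dist_le_walk_length_mul (h : ∀ a b, G.Adj a b → dist (y a) (y b) ≤ r) {a b : V}
    (p : G.Walk a b) : dist (y a) (y b) ≤ p.length * r := by
  induction p with
  | nil => simp
  | @cons a c b hac p ih =>
    rw [SimpleGraph.Walk.length_cons]
    push_cast
    linarith [dist_triangle (y a) (y c) (y b), h a c hac]

lemma dist_le_diam_mul [Finite V] (hG : G.Connected) (hr : 0 ≤ r)
    (h : ∀ a b, G.Adj a b → dist (y a) (y b) ≤ r) (a b : V) :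
    dist (y a) (y b) ≤ G.diam * r := by
  obtain ⟨p, hp⟩ := hG.exists_walk_length_eq_dist a b
  have : Nonempty V := hG.nonempty
  have hle : p.length ≤ G.diam :=
    hp ▸ SimpleGraph.dist_le_diam (SimpleGraph.connected_iff_ediam_ne_top.1 hG)
  exact (dist_le_walk_length_mul h p).trans
    (mul_le_mul_of_nonneg_right (Nat.cast_le.2 hle) hr)

end Graph

/-! ### The closed loop -/

namespace AgentNetwork

variable {N m n : ℕ} {S : AgentNetwork N m n}

/-- The outputs at which the coupling law is defined at time `t`.  It is empty unless `ψᵢⱼᵖ(t) > 0`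
on all edges. -/
def couplingDomain (S : AgentNetwork N m n) (t : ℝ) : Set (Fin N → Fin m → ℝ) :=
  {y | ∀ i j, S.G.Adj i j → ∀ p, |y j p - y i p| < S.ψ i j p t}

lemma le_Psi {i j : Fin N} (hij : S.G.Adj i j) (p : Fin m) (t : ℝ) : S.ψ i j p t ≤ S.Psi t :=
  le_ciSup (f := fun q : {q : Fin N × Fin N × Fin m // S.G.Adj q.1 q.2.1} =>
    S.ψ q.1.1 q.1.2.1 q.1.2.2 t) (finite_range _).bddAbove ⟨(i, j, p), hij⟩

lemma Psi_nonneg {t : ℝ} {y : Fin N → Fin m → ℝ} (hy : y ∈ S.couplingDomain t) : 0 ≤ S.Psi t :=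
  Real.iSup_nonneg fun q => (abs_nonneg _).trans (hy _ _ q.2 _).le

lemma norm_output_sub_le (hG : S.G.Connected) {t : ℝ} {y : Fin N → Fin m → ℝ}
    (hy : y ∈ S.couplingDomain t) (i j : Fin N) : ‖y j - y i‖ ≤ S.funnelRadius t := by
  rw [← dist_eq_norm']
  refine dist_le_diam_mul hG (Psi_nonneg hy) (fun a b hab => ?_) i j
  exact dist_comm (y a) (y b) ▸ (dist_pi_le_iff (Psi_nonneg hy)).2 fun p =>
    (hy a b hab p).le.trans (le_Psi hab p t)

lemma exists_funnelRadius_le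
    (hψ : ∀ i j, S.G.Adj i j → ∀ p, ∃ C : ℝ, ∀ t, S.t₀ ≤ t → S.ψ i j p t ≤ C) :
    ∃ R : ℝ, 0 ≤ R ∧ ∀ t, S.t₀ ≤ t → S.funnelRadius t ≤ R := by
  choose C hC using fun q : {q : Fin N × Fin N × Fin m // S.G.Adj q.1 q.2.1} => hψ _ _ q.2 q.1.2.2
  have hC₀ : 0 ≤ ⨆ q, |C q| := Real.iSup_nonneg fun q => abs_nonneg (C q)
  refine ⟨S.G.diam * ⨆ q, |C q|, mul_nonneg (Nat.cast_nonneg _) hC₀, fun t ht => ?_⟩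
  refine mul_le_mul_of_nonneg_left (Real.iSup_le (fun q => ?_) hC₀) (Nat.cast_nonneg _)
  exact (hC q t ht).trans ((le_abs_self _).trans
    (le_ciSup (f := fun q => |C q|) (finite_range _).bddAbove q))

/-- The coupling terms of all agents cancel, so that the average of the outputs evolves as if the
agents were uncoupled. -/
def BalancedCoupling (S : AgentNetwork N m n) : Prop :=
  ∀ t, S.t₀ ≤ t → ∀ (w : (i : Fin N) → Fin (S.k i) → ℝ), ∀ y ∈ S.couplingDomain t,
    ∑ i, S.Γ i t (w i) *ᵥ S.coupling i t (w i) y = 0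

open Classical in
lemma gain_mulVec_coupling {i : Fin N} {t : ℝ} {w : Fin (S.k i) → ℝ} (hΓ : IsUnit (S.Γ i t w))
    (y : Fin N → Fin m → ℝ) :
    S.Γ i t w *ᵥ S.coupling i t w y = ∑ j,
      if S.G.Adj i j then (fun p => S.μ i j p ((y j p - y i p) / S.ψ i j p t)) else 0 := by
  rw [coupling, Matrix.mulVec_mulVec,
    Matrix.mul_nonsing_inv _ ((Matrix.isUnit_iff_isUnit_det _).1 hΓ), Matrix.one_mulVec,
    Finset.sum_filter]

lemma balancedCoupling (hΓ : ∀ i t, S.t₀ ≤ t → ∀ w, IsUnit (S.Γ i t w))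
    (hψ : ∀ i j, S.G.Adj i j → ∀ p t, S.t₀ ≤ t → S.ψ i j p t = S.ψ j i p t)
    (hμ : ∀ i j, S.G.Adj i j → ∀ p, ∀ s ∈ Ioo (-1 : ℝ) 1, S.μ i j p (-s) = -S.μ j i p s) :
    S.BalancedCoupling := by
  classical
  intro t ht w y hy
  simp only [gain_mulVec_coupling (hΓ _ t ht _)]
  refine sum_sum_eq_zero_of_antisymm fun i j => ?_
  by_cases hij : S.G.Adj i j
  · rw [if_pos hij, if_pos hij.symm]
    ext p
    have hlt := hy j i hij.symm p
    have hpos : 0 < S.ψ j i p t := (abs_nonneg _).trans_lt hlt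
    have hmem : (y i p - y j p) / S.ψ j i p t ∈ Ioo (-1 : ℝ) 1 := by
      rwa [mem_Ioo, ← abs_lt, abs_div, abs_of_pos hpos, div_lt_one hpos]
    rw [Pi.neg_apply, ← hμ i j hij p _ hmem, ← neg_div, neg_sub, hψ i j hij p t ht]
  · rw [if_neg hij, if_neg fun hji => hij hji.symm, neg_zero]

/-- The input `(e₀, (e₁, …, e_N), (d₁, …, d_N))` under which the average output and the internal
state of agent `i` solve the perturbed reduced order blended dynamics. -/
noncomputable def deviation (i : Fin N) (y : Fin N → Fin m → ℝ) (z : Fin N → Fin n → ℝ) :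
    (Fin m → ℝ) × (Fin N → Fin m → ℝ) × (Fin N → Fin n → ℝ) :=
  (y i - arithMean y, fun j => y j - arithMean y, fun j => z j - z i)

lemma norm_deviation_le {y : Fin N → Fin m → ℝ} {z : Fin N → Fin n → ℝ} {r : ℝ}
    (hy : ∀ i j, ‖y j - y i‖ ≤ r) (hz : ∀ i j, ‖z j - z i‖ ≤ r) (i : Fin N) :
    ‖deviation i y z‖ ≤ r := by
  have : Nonempty (Fin N) := ⟨i⟩
  have hr : 0 ≤ r := (norm_nonneg _).trans (hy i i)
  have hmean : ∀ j, ‖y j - arithMean y‖ ≤ r := fun j => norm_sub_arithMean_le fun k => hy k j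
  exact max_le (hmean i) (max_le ((pi_norm_le_iff_of_nonneg hr).2 hmean)
    ((pi_norm_le_iff_of_nonneg hr).2 (hz i)))

lemma perturbedReduced_zero (t : ℝ) (x : (Fin m → ℝ) × (Fin n → ℝ)) :
    S.perturbedReduced t x 0 = S.reducedBlended t x := by
  simp [perturbedReduced, reducedBlended]

namespace IsClosedLoopSol

variable {ω : EReal} {y : ℝ → Fin N → Fin m → ℝ} {z : ℝ → Fin N → Fin n → ℝ} {T : ℝ}

lemma mem_couplingDomain (h : S.IsClosedLoopSol ω y z) (hT : (T : EReal) < ω) {t : ℝ}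
    (ht : t ∈ Icc S.t₀ T) : y t ∈ S.couplingDomain t :=
  h.mem_domain t ht.1 ((EReal.coe_le_coe_iff.2 ht.2).trans_lt hT)

lemma funnelRadius_nonneg (h : S.IsClosedLoopSol ω y z) (hT : (T : EReal) < ω) {t : ℝ}
    (ht : t ∈ Ico S.t₀ T) : 0 ≤ S.funnelRadius t :=
  mul_nonneg (Nat.cast_nonneg _) (Psi_nonneg (h.mem_couplingDomain hT (Ico_subset_Icc_self ht)))

lemma isSolOn_internal (h : S.IsClosedLoopSol ω y z) (hT : (T : EReal) < ω) (i : Fin N) :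
    IsSolOn (fun t x => S.Z t x (y t i)) S.t₀ T (fun t => z t i) :=
  (h.sol.isSolOn hT).map ((ContinuousLinearMap.proj (R := ℝ) i).comp
    (ContinuousLinearMap.snd ℝ (Fin N → Fin m → ℝ) (Fin N → Fin n → ℝ))) fun _ _ => rfl

lemma continuousOn_output (h : S.IsClosedLoopSol ω y z) (hT : (T : EReal) < ω) :
    ContinuousOn y (Icc S.t₀ T) :=
  (h.sol.isSolOn hT).continuousOn.fst

lemma continuousOn_internal (h : S.IsClosedLoopSol ω y z) (hT : (T : EReal) < ω) :
    ContinuousOn z (Icc S.t₀ T) :=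
  (h.sol.isSolOn hT).continuousOn.snd

lemma continuousOn_deviation (h : S.IsClosedLoopSol ω y z) (hT : (T : EReal) < ω) (i : Fin N) :
    ContinuousOn (fun t => deviation i (y t) (z t)) (Icc S.t₀ T) := by
  have hy := h.continuousOn_output hT
  have hz := h.continuousOn_internal hT
  unfold deviation
  fun_prop

lemma isSolOn_perturbedReduced (h : S.IsClosedLoopSol ω y z) (hS : S.BalancedCoupling)
    (hT : (T : EReal) < ω) (i : Fin N) :
    IsSolOn (fun t x => S.perturbedReduced t x (deviation i (y t) (z t))) S.t₀ T
      (fun t => (arithMean (y t), z t i)) := by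
  refine (h.sol.isSolOn hT).map (arithMean.prodMap (ContinuousLinearMap.proj i)) fun t ht => ?_
  have hsum := hS t ht.1 (fun j => S.W j (y t j) (z t j)) (y t) (h.mem_couplingDomain hT ht)
  simp [closedLoop, perturbedReduced, deviation, arithMean_fin_apply, Finset.sum_add_distrib, hsum]

lemma norm_internal_sub_le (h : S.IsClosedLoopSol ω y z) (hT : (T : EReal) < ω) (hT₀ : S.t₀ ≤ T)
    {β : ℝ → ℝ → ℝ} {γ w ρ : ℝ → ℝ} (hZ : DeltaISS S.t₀ S.Z β γ) (hw : IsDecayWeight w)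
    {M R : ℝ} (hR : 0 ≤ R) {i j : Fin N} (hM : ‖z S.t₀ j - z S.t₀ i‖ ≤ M)
    (hy : ∀ s ∈ Ico S.t₀ T, ‖y s j - y s i‖ ≤ ρ s) (hρ : ∀ s ∈ Ico S.t₀ T, ρ s ≤ R) :
    ‖z T j - z T i‖ ≤ β ‖z S.t₀ j - z S.t₀ i‖ (T - S.t₀) +
      fadingGain β γ w (β M 0 + γ R) (weightedSup ρ w S.t₀ T) :=
  have hcont := continuousOn_pi.1 (h.continuousOn_output hT)
  hZ.estimate_weightedSup le_rfl hT₀ (hcont j) (hcont i) (h.isSolOn_internal hT j)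
    (h.isSolOn_internal hT i) hw hM hR hy hρ

lemma norm_arithMean_sub_le (h : S.IsClosedLoopSol ω y z) (hT : (T : EReal) < ω)
    (hT₀ : S.t₀ ≤ T) (hS : S.BalancedCoupling) {β : ℝ → ℝ → ℝ} {γ w ρ : ℝ → ℝ}
    (hred : DeltaISS S.t₀ S.perturbedReduced β γ) (hw : IsDecayWeight w) {M R : ℝ} (hR : 0 ≤ R)
    (hyρ : ∀ s ∈ Ico S.t₀ T, ∀ i j, ‖y s j - y s i‖ ≤ ρ s)
    (hzρ : ∀ s ∈ Ico S.t₀ T, ∀ i j, ‖z s j - z s i‖ ≤ ρ s) (hρ : ∀ s ∈ Ico S.t₀ T, ρ s ≤ R)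
    {s' : ℝ → Fin m → ℝ} {z' : ℝ → Fin n → ℝ}
    (hsol : IsSolOn S.reducedBlended S.t₀ T (fun t => (s' t, z' t)))
    (hs' : s' S.t₀ = arithMean (y S.t₀)) {i : Fin N} (hM : ‖z S.t₀ i - z' S.t₀‖ ≤ M) :
    ‖(arithMean (y T) - s' T, z T i - z' T)‖ ≤ β ‖z S.t₀ i - z' S.t₀‖ (T - S.t₀) +
      fadingGain β γ w (β M 0 + γ R) (weightedSup ρ w S.t₀ T) := by
  have hinit : ‖(arithMean (y S.t₀), z S.t₀ i) - (s' S.t₀, z' S.t₀)‖ = ‖z S.t₀ i - z' S.t₀‖ := by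
    simp [hs', Prod.norm_def]
  have hsol₀ : IsSolOn (fun t x => S.perturbedReduced t x 0) S.t₀ T (fun t => (s' t, z' t)) :=
    hsol.congr (fun _ _ => rfl) fun t _ => (perturbedReduced_zero t _).symm
  have hest := hred.estimate_weightedSup le_rfl hT₀ (h.continuousOn_deviation hT i)
    continuousOn_const (h.isSolOn_perturbedReduced hS hT i) hsol₀ hw (hinit.trans_le hM) hR
    (fun s hs => by simpa only [sub_zero] using norm_deviation_le (hyρ s hs) (hzρ s hs) i) hρ
  rwa [hinit] at hest

end IsClosedLoopSol

/-! ### Synchronization and approximation by the blended dynamics -/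

lemma D_le {βt : ℝ → ℝ → ℝ} {γt wt : ℝ → ℝ} (hβ : ClassKL βt) (hγ : ClassKInf γt)
    (hwt : IsDecayWeight wt) {M R t : ℝ} (hM : 0 ≤ M) (hR : 0 ≤ R) (ht : S.t₀ ≤ t)
    (hr : ∀ s ∈ Ico S.t₀ t, 0 ≤ S.funnelRadius s) (hrR : ∀ s ∈ Ico S.t₀ t, S.funnelRadius s ≤ R)
    {z₀ : Fin N → Fin n → ℝ} (hz₀ : ∀ i j, ‖z₀ j - z₀ i‖ ≤ M) :
    S.D βt γt wt z₀ t ≤ βt M 0 + γt R := by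
  refine add_le_add (Real.iSup_le (fun q => ?_) (hβ.nonneg hM le_rfl)) ?_
  · exact hβ.le_apply_zero (norm_nonneg _) (hz₀ q.1 q.2) (sub_nonneg.2 ht)
  · exact hγ.monotoneOn (weightedSup_nonneg hwt hr) hR (weightedSup_le hwt hr hrR hR)

lemma le_D {βt : ℝ → ℝ → ℝ} {γt wt : ℝ → ℝ} {z₀ : Fin N → Fin n → ℝ} {t : ℝ} (i j : Fin N) :
    βt ‖z₀ j - z₀ i‖ (t - S.t₀) + γt (weightedSup S.funnelRadius wt S.t₀ t) ≤
      S.D βt γt wt z₀ t :=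
  add_le_add_left (le_ciSup (f := fun q : Fin N × Fin N => βt ‖z₀ q.2 - z₀ q.1‖ (t - S.t₀))
    (finite_range _).bddAbove (i, j)) _

theorem exists_dBoundsInternal (hG : S.G.Connected)
    (hψ : ∀ i j, S.G.Adj i j → ∀ p, ∃ C : ℝ, ∀ t, S.t₀ ≤ t → S.ψ i j p t ≤ C)
    {βt : ℝ → ℝ → ℝ} {γb wt : ℝ → ℝ} (hZ : DeltaISS S.t₀ S.Z βt γb) (hwt : IsDecayWeight wt)
    {M : ℝ} (hM : 0 ≤ M) : ∃ γt, ClassKInf γt ∧ S.DBoundsInternal M βt γt wt := by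
  obtain ⟨R, hR, hrR⟩ := exists_funnelRadius_le hψ
  have hK : 0 ≤ βt M 0 + γb R :=
    add_nonneg (hZ.classKL.nonneg hM le_rfl) (hZ.classKInf.nonneg hR)
  obtain ⟨γt, hγt, hle⟩ := exists_classKInf_ge_fadingGain hZ.classKL hZ.classKInf hwt.pos hK
  refine ⟨γt, hγt, fun ω y z h hz t ht htω i j => ?_⟩
  calc ‖z t j - z t i‖
      ≤ βt ‖z S.t₀ j - z S.t₀ i‖ (t - S.t₀) +
          fadingGain βt γb wt (βt M 0 + γb R) (weightedSup S.funnelRadius wt S.t₀ t) :=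
        h.norm_internal_sub_le htω ht hZ hwt hR (hz i j)
          (fun s hs => norm_output_sub_le hG
            (h.mem_couplingDomain htω (Ico_subset_Icc_self hs)) i j) fun s hs => hrR s hs.1
    _ ≤ βt ‖z S.t₀ j - z S.t₀ i‖ (t - S.t₀) + γt (weightedSup S.funnelRadius wt S.t₀ t) :=
        add_le_add_right (hle _ (weightedSup_nonneg hwt fun s hs =>
          h.funnelRadius_nonneg htω hs)) _
    _ ≤ S.D βt γt wt (z S.t₀) t := le_D i j

theorem IsClosedLoopSol.norm_sub_reducedBlended_le {ω : EReal} {y : ℝ → Fin N → Fin m → ℝ}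
    {z : ℝ → Fin N → Fin n → ℝ} (h : S.IsClosedLoopSol ω y z) {t : ℝ} (ht : S.t₀ ≤ t)
    (htω : (t : EReal) < ω) (hS : S.BalancedCoupling) (hG : S.G.Connected) {β : ℝ → ℝ → ℝ}
    {γ w ρ : ℝ → ℝ} (hred : DeltaISS S.t₀ S.perturbedReduced β γ) (hw : IsDecayWeight w) {M R : ℝ}
    (hR : 0 ≤ R) (hyρ : ∀ s ∈ Ico S.t₀ t, S.funnelRadius s ≤ ρ s)
    (hzρ : ∀ s ∈ Ico S.t₀ t, ∀ i j, ‖z s j - z s i‖ ≤ ρ s) (hρ : ∀ s ∈ Ico S.t₀ t, ρ s ≤ R)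
    (hM : ∀ i j, ‖z S.t₀ j - z S.t₀ i‖ ≤ M) {s' : ℝ → Fin m → ℝ} {z' : ℝ → Fin n → ℝ}
    (hsol : IsSolOn S.reducedBlended S.t₀ t (fun t => (s' t, z' t)))
    (hs' : s' S.t₀ = arithMean (y S.t₀)) (hz' : z' S.t₀ = arithMean (z S.t₀)) (i : Fin N) :
    ‖(y t i - s' t, z t i - z' t)‖ ≤ β ‖z S.t₀ i - z' S.t₀‖ (t - S.t₀) +
      fadingGain β γ w (β M 0 + γ R) (weightedSup ρ w S.t₀ t) + S.funnelRadius t := by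
  have : Nonempty (Fin N) := ⟨i⟩
  have hfunnel : ∀ s ∈ Icc S.t₀ t, ∀ i j, ‖y s j - y s i‖ ≤ S.funnelRadius s := fun s hs =>
    norm_output_sub_le hG (h.mem_couplingDomain htω hs)
  have hmean : ‖y t i - arithMean (y t)‖ ≤ S.funnelRadius t :=
    norm_sub_arithMean_le fun j => hfunnel t ⟨ht, le_rfl⟩ j i
  calc ‖(y t i - s' t, z t i - z' t)‖
      = ‖(arithMean (y t) - s' t, z t i - z' t) + (y t i - arithMean (y t), 0)‖ := by
        rw [Prod.mk_add_mk, sub_add_sub_cancel', add_zero]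
    _ ≤ ‖(arithMean (y t) - s' t, z t i - z' t)‖ + ‖(y t i - arithMean (y t), (0 : Fin n → ℝ))‖ :=
        norm_add_le _ _
    _ ≤ _ := by
        refine add_le_add (h.norm_arithMean_sub_le htω ht hS hred hw hR (fun s hs i j => ?_) hzρ hρ
          hsol hs' (hz' ▸ norm_sub_arithMean_le fun j => hM j i)) ?_
        · exact (hfunnel s (Ico_subset_Icc_self hs) i j).trans (hyρ s hs)
        · simpa [Prod.norm_def] using hmean

theorem IsClosedLoopSol.norm_sub_reducedBlended_le_D {ω : EReal} {y : ℝ → Fin N → Fin m → ℝ}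
    {z : ℝ → Fin N → Fin n → ℝ} (h : S.IsClosedLoopSol ω y z) {t : ℝ} (ht : S.t₀ ≤ t)
    (htω : (t : EReal) < ω) (hS : S.BalancedCoupling) (hG : S.G.Connected) {β βt : ℝ → ℝ → ℝ}
    {γ γt w wt : ℝ → ℝ} (hred : DeltaISS S.t₀ S.perturbedReduced β γ) (hw : IsDecayWeight w)
    (hβt : ClassKL βt) (hγt : ClassKInf γt) (hwt : IsDecayWeight wt) {M R : ℝ} (hM : 0 ≤ M)
    (hR : 0 ≤ R) (hrR : ∀ s ∈ Ico S.t₀ t, S.funnelRadius s ≤ R)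
    (hz : ∀ i j, ‖z S.t₀ j - z S.t₀ i‖ ≤ M)
    (hzD : ∀ s ∈ Ico S.t₀ t, ∀ i j, ‖z s j - z s i‖ ≤ S.D βt γt wt (z S.t₀) s)
    {s' : ℝ → Fin m → ℝ} {z' : ℝ → Fin n → ℝ}
    (hsol : IsSolOn S.reducedBlended S.t₀ t (fun t => (s' t, z' t)))
    (hs' : s' S.t₀ = arithMean (y S.t₀)) (hz' : z' S.t₀ = arithMean (z S.t₀)) (i : Fin N) :
    ‖(y t i - s' t, z t i - z' t)‖ ≤ β ‖z S.t₀ i - z' S.t₀‖ (t - S.t₀) +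
      fadingGain β γ w (β M 0 + γ (max R (βt M 0 + γt R)))
        (weightedSup (fun s => max (S.funnelRadius s) (S.D βt γt wt (z S.t₀) s)) w S.t₀ t) +
      S.funnelRadius t := by
  have hDR : ∀ s ∈ Ico S.t₀ t, S.D βt γt wt (z S.t₀) s ≤ βt M 0 + γt R := fun s hs =>
    have hsub : Ico S.t₀ s ⊆ Ico S.t₀ t := Ico_subset_Ico_right hs.2.le
    D_le hβt hγt hwt hM hR hs.1 (fun σ hσ => h.funnelRadius_nonneg htω (hsub hσ))
      (fun σ hσ => hrR σ (hsub hσ)) hz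
  exact h.norm_sub_reducedBlended_le ht htω hS hG hred hw (hR.trans (le_max_left _ _))
    (fun s _ => le_max_left _ _) (fun s hs i j => (hzD s hs i j).trans (le_max_right _ _))
    (fun s hs => max_le_max (hrR s hs) (hDR s hs)) hz hsol hs' hz' i

end AgentNetwork

theorem corollary3_general {N m n : ℕ} (S : AgentNetwork N m n) (h_coupling : S.BalancedCoupling)
    (h_graph : S.G.Connected)
    (h_bounded : ∀ i j, S.G.Adj i j → ∀ p, ∃ C : ℝ, ∀ t, S.t₀ ≤ t → S.ψ i j p t ≤ C)
    (βt : ℝ → ℝ → ℝ) (γb : ℝ → ℝ) (h_internal : DeltaISS S.t₀ S.Z βt γb)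
    (β : ℝ → ℝ → ℝ) (γh : ℝ → ℝ) (h_reduced : DeltaISS S.t₀ S.perturbedReduced β γh)
    (M : ℝ) (hM : 0 ≤ M) (wt : ℝ → ℝ) (hwt : IsDecayWeight wt) :
    (∃ γt : ℝ → ℝ, ClassKInf γt ∧ S.DBoundsInternal M βt γt wt) ∧
    ∀ γt : ℝ → ℝ, ClassKInf γt → S.DBoundsInternal M βt γt wt →
      ∀ w : ℝ → ℝ, IsDecayWeight w →
        ∃ γ : ℝ → ℝ, ClassKInf γ ∧
          ∀ (ω : EReal) (y : ℝ → Fin N → Fin m → ℝ) (z : ℝ → Fin N → Fin n → ℝ),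
            S.IsClosedLoopSol ω y z → (∀ i j, ‖z S.t₀ j - z S.t₀ i‖ ≤ M) →
            ∀ (s' : ℝ → Fin m → ℝ) (z' : ℝ → Fin n → ℝ),
              IsCaratheodorySol S.reducedBlended S.t₀ ⊤ (fun t => (s' t, z' t)) →
              s' S.t₀ = (1 / (N : ℝ)) • ∑ i, y S.t₀ i →
              z' S.t₀ = (1 / (N : ℝ)) • ∑ i, z S.t₀ i →
              ∀ (i : Fin N) (t : ℝ), S.t₀ ≤ t → (t : EReal) < ω →
                ‖(y t i - s' t, z t i - z' t)‖ ≤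
                  β ‖z S.t₀ i - z' S.t₀‖ (t - S.t₀) +
                  γ (sSup ((fun s => max (S.funnelRadius s) (S.D βt γt wt (z S.t₀) s) *
                    w (t - s)) '' Ico S.t₀ t)) +
                  S.funnelRadius t := by
  refine ⟨AgentNetwork.exists_dBoundsInternal h_graph h_bounded h_internal hwt hM,
    fun γt hγt hD w hw => ?_⟩
  obtain ⟨R, hR, hrR⟩ := AgentNetwork.exists_funnelRadius_le h_bounded
  obtain ⟨γ, hγ, hle⟩ := exists_classKInf_ge_fadingGain h_reduced.classKL h_reduced.classKInf hw.pos
    (add_nonneg (h_reduced.classKL.nonneg hM le_rfl)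
      (h_reduced.classKInf.nonneg (hR.trans (le_max_left R (βt M 0 + γt R)))))
  refine ⟨γ, hγ, fun ω y z h hz s' z' hsol hs' hz' i t ht htω => ?_⟩
  rw [← arithMean_fin_apply] at hs' hz'
  have hzD : ∀ s ∈ Ico S.t₀ t, ∀ i j, ‖z s j - z s i‖ ≤ S.D βt γt wt (z S.t₀) s := fun s hs =>
    hD ω y z h hz s hs.1 ((EReal.coe_lt_coe_iff.2 hs.2).trans htω)
  refine (h.norm_sub_reducedBlended_le_D ht htω h_coupling h_graph h_reduced hw h_internal.classKL
    hγt hwt hM hR (fun s hs => hrR s hs.1) hz hzD (hsol.isSolOn (EReal.coe_lt_top t)) hs' hz'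
    i).trans (add_le_add_left (add_le_add_right (hle _ ?_) _) _)
  exact weightedSup_nonneg hw fun s hs => (h.funnelRadius_nonneg htω hs).trans (le_max_left _ _)

theorem corollary3 {N m n : ℕ} (S : AgentNetwork N m n)
    (h_open : S.OpenLoop) (h_gain : S.GainMatrix) (h_graph : S.G.Connected)
    (h_design : S.DesignFunctions) (h_escape : S.NoFiniteEscape)
    (βt : ℝ → ℝ → ℝ) (γb : ℝ → ℝ) (h_internal : DeltaISS S.t₀ S.Z βt γb)
    (β : ℝ → ℝ → ℝ) (γh : ℝ → ℝ) (h_reduced : DeltaISS S.t₀ S.perturbedReduced β γh)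
    (M : ℝ) (hM : 0 < M) (wt : ℝ → ℝ) (hwt : IsDecayWeight wt) :
    (∃ γt : ℝ → ℝ, ClassKInf γt ∧ S.DBoundsInternal M βt γt wt) ∧
    ∀ γt : ℝ → ℝ, ClassKInf γt → S.DBoundsInternal M βt γt wt →
      ∀ w : ℝ → ℝ, IsDecayWeight w →
        ∃ γ : ℝ → ℝ, ClassKInf γ ∧
          ∀ (ω : EReal) (y : ℝ → Fin N → Fin m → ℝ) (z : ℝ → Fin N → Fin n → ℝ),
            S.IsClosedLoopSol ω y z → (∀ i j, ‖z S.t₀ j - z S.t₀ i‖ ≤ M) →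
            ∀ (s' : ℝ → Fin m → ℝ) (z' : ℝ → Fin n → ℝ),
              IsCaratheodorySol S.reducedBlended S.t₀ ⊤ (fun t => (s' t, z' t)) →
              s' S.t₀ = (1 / (N : ℝ)) • ∑ i, y S.t₀ i →
              z' S.t₀ = (1 / (N : ℝ)) • ∑ i, z S.t₀ i →
              ∀ (i : Fin N) (t : ℝ), S.t₀ ≤ t → (t : EReal) < ω →
                ‖(y t i - s' t, z t i - z' t)‖ ≤
                  β ‖z S.t₀ i - z' S.t₀‖ (t - S.t₀) +
                  γ (sSup ((fun s => max (S.funnelRadius s) (S.D βt γt wt (z S.t₀) s) *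
                    w (t - s)) '' Ico S.t₀ t)) +
                  S.funnelRadius t :=
  corollary3_general S (AgentNetwork.balancedCoupling h_gain.isUnit h_design.ψ_symm h_design.μ_symm)
    h_graph h_design.ψ_bounded βt γb h_internal β γh h_reduced M hM.le wt hwt
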